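/- Let $n\ge 3$ and let $C_n$ be the cycle graph on $n$ vertices. Let $\mathcal S(C_n)$ be the set of real symmetric $n\times n$ matrices $A=[a_{ij}]$ such that, for all $i\ne j$, $a_{ij}\ne 0$ if and only if $ij$ is an edge of $C_n$ (the diagonal entries are unrestricted). A real symmetric matrix $A$ has the Strong Spectral Property (SSP) if the only real symmetric matrix $X$ satisfying $A\circ X=O$, $I\circ X=O$ and $AX-XA=O$ is $X=O$, where $\circ$ denotes the entrywise product. Then for any real numbers $\lambda_1<\dots<\lambda_{n-1}$ and any integer $k$ with $1\le k\le n-1$, there exists a matrix $A\in\mathcal S(C_n)$ with the SSP such that $\lambda_k$ is an eigenvalue of $A$ of multiplicity $2$ and, for every $i\ne k$, $\lambda_i$ is an eigenvalue of $A$ of multiplicity $1$. -/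

import Mathlib

/-- The set `S(G)` of real symmetric matrices described by the graph `G`: off the diagonal, the
`(i, j)` entry is nonzero exactly when `ij` is an edge of `G`; the diagonal is unrestricted. -/
def matricesOfGraph {V : Type*} (G : SimpleGraph V) : Set (Matrix V V ℝ) :=
  {A | A.IsSymm ∧ ∀ i j, i ≠ j → (A i j ≠ 0 ↔ G.Adj i j)}

/-- The Strong Spectral Property of a (symmetric) matrix `A`: the only symmetric matrix `X` with
`A ∘ X = O`, `I ∘ X = O` (entrywise products) and `[A, X] = O` is `X = O`. -/
def HasSSP {V : Type*} [Fintype V] [DecidableEq V] (A : Matrix V V ℝ) : Prop :=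
  ∀ X : Matrix V V ℝ, X.IsSymm →
    Matrix.hadamard A X = 0 → Matrix.hadamard (1 : Matrix V V ℝ) X = 0 →
    A * X - X * A = 0 → X = 0

/-! Start from a diagonal matrix `D` with the prescribed spectrum, the repeated value at two
adjacent vertices. By the inverse function theorem, some orthogonal conjugate `A` of `D` has a small
`ε` at each edge and 0 at each non-edge, wherever the two diagonal values differ. Only one
off-diagonal pair stays uncontrolled, the edge joining the two equal values. If `A` vanished there,
it would be carried by a path, whose eigenvalues are simple, against the double eigenvalue. The SSP
holds for `A` close to `D`, since injectivity of a linear map is an open condition. -/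

open Filter Topology in
open scoped Matrix.Norms.Operator in
/-- Matrices near `diagonal d` commute with no nonzero matrix that vanishes at the positions
`(i, j)` with `d i = d j`. -/
theorem Matrix.eventually_commutator_ne_zero {ι : Type*} [Fintype ι] [DecidableEq ι] (d : ι → ℝ) :
    ∀ᶠ A in 𝓝 (Matrix.diagonal d), ∀ X : Matrix ι ι ℝ, (∀ i j, d i = d j → X i j = 0) →
      A * X - X * A = 0 → X = 0 := by
  let P : Matrix ι ι ℝ →L[ℝ] Matrix ι ι ℝ := LinearMap.toContinuousLinearMap
    { toFun := fun X => Matrix.of fun i j => if d i = d j then X i j else 0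
      map_add' := fun X Y => by
        ext i j; simp only [Matrix.of_apply, Matrix.add_apply]; split_ifs <;> simp
      map_smul' := fun c X => by ext i j; simp [Matrix.smul_apply] }
  have hP : ∀ X i j, P X i j = if d i = d j then X i j else 0 := fun _ _ _ => rfl
  let m := ContinuousLinearMap.mul ℝ (Matrix ι ι ℝ)
  let L : Matrix ι ι ℝ → Matrix ι ι ℝ →L[ℝ] Matrix ι ι ℝ × Matrix ι ι ℝ := fun A =>
    (m A - m.flip A).prod P
  have hL : ∀ A X, L A X = (A * X - X * A, P X) := fun _ _ => rfl
  have hcont : Continuous L := by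
    have h1 : Continuous fun A => m A - m.flip A := by fun_prop
    exact (ContinuousLinearMap.prodₗᵢ (𝕜 := ℝ) (E := Matrix ι ι ℝ) (F := Matrix ι ι ℝ)
      (G := Matrix ι ι ℝ) ℝ).continuous.comp (h1.prodMk continuous_const)
  have hinj : Function.Injective (L (Matrix.diagonal d)) := by
    refine (injective_iff_map_eq_zero _).2 fun X hX => ?_
    rw [hL, Prod.mk_eq_zero] at hX
    ext i j
    have h1 := congrFun (congrFun hX.1 i) j
    have h2 := congrFun (congrFun hX.2 i) j
    rw [hP] at h2
    rw [Matrix.sub_apply, Matrix.diagonal_mul, Matrix.mul_diagonal] at h1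
    by_cases h : d i = d j
    · simpa [h] using h2
    · have : (d i - d j) * X i j = 0 := by
        rw [Matrix.zero_apply] at h1; linarith
      simpa [sub_ne_zero.2 h] using this
  have hev : ∀ᶠ A in 𝓝 (Matrix.diagonal d), Function.Injective (L A) :=
    hcont.continuousAt.eventually (ContinuousLinearMap.isOpen_injective.mem_nhds hinj)
  filter_upwards [hev] with A hA X hX hc
  refine (injective_iff_map_eq_zero _).1 hA X ?_
  rw [hL, hc, Prod.mk_eq_zero]
  refine ⟨rfl, ?_⟩
  ext i j
  rw [hP]
  split_ifs with h
  · exact hX i j h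
  · rfl

open Filter Topology NormedSpace in
open scoped Matrix.Norms.Operator in
/-- Symmetric matrices orthogonally similar and close to `diagonal d` may be prescribed freely
at the positions `(i, j)` with `d i ≠ d j`. -/
theorem Matrix.eventually_exists_orthogonal_conj_diagonal {ι : Type*} [Fintype ι] [DecidableEq ι]
    (d : ι → ℝ) {p : Matrix ι ι ℝ → Prop} (hp : ∀ᶠ A in 𝓝 (Matrix.diagonal d), p A) :
    ∀ᶠ T in 𝓝 (Matrix.diagonal d), T.IsSymm → ∃ Q : Matrix ι ι ℝ, Q.transpose * Q = 1 ∧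
      p (Q.transpose * Matrix.diagonal d * Q) ∧
      ∀ i j, d i ≠ d j → (Q.transpose * Matrix.diagonal d * Q) i j = T i j := by
  let D := Matrix.diagonal d
  -- `K M` is skew, and `[D, K M]` is the symmetric part of `M` where `d i ≠ d j`. Elsewhere
  -- division by zero makes `K M` vanish.
  let K : Matrix ι ι ℝ →L[ℝ] Matrix ι ι ℝ := LinearMap.toContinuousLinearMap
    { toFun := fun M => Matrix.of fun i j => (M i j + M j i) / (2 * (d i - d j))
      map_add' := fun X Y => by ext i j; simp only [Matrix.of_apply, Matrix.add_apply]; ring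
      map_smul' := fun c X => by
        ext i j; simp only [Matrix.of_apply, Matrix.smul_apply, smul_eq_mul, RingHom.id_apply]; ring }
  have hK : ∀ M i j, K M i j = (M i j + M j i) / (2 * (d i - d j)) := fun _ _ _ => rfl
  have hKt : ∀ M, (K M).transpose = -K M := fun M => by
    ext i j
    rw [Matrix.transpose_apply, Matrix.neg_apply, hK, hK, ← neg_sub (d i), mul_neg, div_neg,
      add_comm]
  have hcomm : ∀ M i j, (D * K M - K M * D) i j = if d i = d j then 0 else (M i j + M j i) / 2 := by
    intro M i j
    rw [Matrix.sub_apply, Matrix.diagonal_mul, Matrix.mul_diagonal, hK]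
    split_ifs with h
    · simp [h]
    · have := sub_ne_zero.2 h
      field_simp
  let ψ : Matrix ι ι ℝ → Matrix ι ι ℝ := fun M => exp (-K M) * D * exp (K M)
  -- The added term makes the derivative at 0 the identity. Where `d i ≠ d j` it is the skew part of
  -- `M`, hence zero once `Φ M` is symmetric.
  let Φ : Matrix ι ι ℝ → Matrix ι ι ℝ := fun M => ψ M + (M - (D * K M - K M * D))
  have hψ0 : ψ 0 = D := by simp [ψ]
  have hΦ0 : Φ 0 = D := by simp [Φ, hψ0]
  have hexp : HasStrictFDerivAt (exp : Matrix ι ι ℝ → Matrix ι ι ℝ) (1 : Matrix ι ι ℝ →L[ℝ] _) 0 :=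
    hasStrictFDerivAt_exp_zero
  have hE : HasStrictFDerivAt (fun M => exp (K M)) K 0 := by
    have h0 : HasStrictFDerivAt (exp : Matrix ι ι ℝ → Matrix ι ι ℝ)
      (1 : Matrix ι ι ℝ →L[ℝ] _) (K 0) := by rwa [map_zero]
    exact h0.comp 0 K.hasStrictFDerivAt
  have hE' : HasStrictFDerivAt (fun M => exp (-K M)) (-K) 0 := by
    have h0 : HasStrictFDerivAt (exp : Matrix ι ι ℝ → Matrix ι ι ℝ)
      (1 : Matrix ι ι ℝ →L[ℝ] _) ((-K) 0) := by rwa [map_zero]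
    exact h0.comp 0 (-K).hasStrictFDerivAt
  have hψ := (hE'.mul_const' D).mul' hE
  have hK0 : HasStrictFDerivAt K K 0 := K.hasStrictFDerivAt
  have hlin := (hasStrictFDerivAt_id (𝕜 := ℝ) (0 : Matrix ι ι ℝ)).sub
    ((hK0.const_mul D).sub (hK0.mul_const' D))
  have hΦ : HasStrictFDerivAt Φ
      (ContinuousLinearEquiv.refl ℝ (Matrix ι ι ℝ) : Matrix ι ι ℝ →L[ℝ] _) 0 := by
    refine (hψ.add hlin).congr_fderiv ?_
    ext1 M
    change (exp (-K 0) * D) * K M + (-K M * D) * exp (K 0) + (M - (D * K M - K M * D)) = M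
    simp only [map_zero, neg_zero, exp_zero, one_mul, mul_one, neg_mul]
    abel
  have hmap := hΦ.map_nhds_eq_of_equiv
  rw [hΦ0] at hmap
  have hev : ∀ᶠ M in 𝓝 0, p (ψ M) := by
    have hc : ContinuousAt ψ 0 := hψ.continuousAt
    refine hc.eventually ?_
    rwa [hψ0]
  have hex : ∀ᶠ T in 𝓝 D, ∃ M, p (ψ M) ∧ Φ M = T :=
    hmap.ge (eventually_map.2 (hev.mono fun M hM => ⟨M, hM, rfl⟩))
  filter_upwards [hex] with T ⟨M, hM, hT⟩ hTs
  have hexpt : (exp (K M)).transpose = exp (-K M) := by rw [← Matrix.exp_transpose, hKt]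
  refine ⟨exp (K M), ?_, ?_, ?_⟩
  · rw [hexpt, Matrix.exp_neg]
    exact Matrix.nonsing_inv_mul _ ((Matrix.isUnit_iff_isUnit_det _).1 (Matrix.isUnit_exp _))
  · rwa [hexpt]
  · intro i j hij
    rw [hexpt]
    change ψ M i j = T i j
    have hψs : (ψ M).IsSymm := by
      change (exp (-K M) * D * exp (K M)).transpose = _
      simp [D, ψ, ← hexpt, Matrix.transpose_mul, Matrix.mul_assoc]
    have e1 := hcomm M i j
    have e2 := hcomm M j i
    have t1 : ψ M i j + (M i j - (D * K M - K M * D) i j) = T i j := by rw [← hT]; rfl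
    have t2 : ψ M j i + (M j i - (D * K M - K M * D) j i) = T j i := by rw [← hT]; rfl
    rw [e1, if_neg hij] at t1
    rw [e2, if_neg hij.symm] at t2
    have s1 := hψs.apply i j
    have s2 := hTs.apply i j
    linarith

open SimpleGraph Fin.CommRing Fin.NatCast in
/-- If a matrix supported on a cycle vanishes at an edge `(p + 1, p)` and at no other edge
`(i, i + 1)`, then each of its eigenvectors is determined by its value at `p + 1`. -/
theorem eq_zero_of_mulVec_eq_smul_of_path {m : ℕ} {A : Matrix (Fin (m + 2)) (Fin (m + 2)) ℝ}
    {p : Fin (m + 2)} (h0 : ∀ i j, i ≠ j → ¬(cycleGraph (m + 2)).Adj i j → A i j = 0)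
    (hp : A (p + 1) p = 0) (h1 : ∀ i, i ≠ p → A i (i + 1) ≠ 0)
    {c : ℝ} {x : Fin (m + 2) → ℝ} (hx : A.mulVec x = c • x) (hxp : x (p + 1) = 0) : x = 0 := by
  -- Walk round the cycle from `p + 1`: once the backward and diagonal terms of a row vanish, so
  -- does the forward one.
  have key : ∀ t : ℕ, x (p + 1 + t) = 0 ∧ A (p + 1 + t) (p + t) * x (p + t) = 0 := by
    intro t
    induction t with
    | zero => simp [hxp, hp]
    | succ t ih =>
      obtain ⟨ih1, ih2⟩ := ih
      have e : p + (t + 1 : ℕ) = p + 1 + (t : Fin (m + 2)) := by push_cast; ring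
      have e' : p + 1 + (t + 1 : ℕ) = p + 1 + (t : Fin (m + 2)) + 1 := by push_cast; ring
      have e'' : p + (t : Fin (m + 2)) = p + 1 + (t : Fin (m + 2)) - 1 := by ring
      rw [e, e', ih1, mul_zero]
      rw [e''] at ih2
      refine ⟨?_, rfl⟩
      generalize p + 1 + (t : Fin (m + 2)) = i at *
      by_cases hi : i = p
      · rw [hi, hxp]
      have hrow := congrFun hx i
      rw [Pi.smul_apply, ih1, smul_zero, Matrix.mulVec, dotProduct,
        Finset.sum_eq_single (i + 1)] at hrow
      · exact (mul_eq_zero.1 hrow).resolve_left (h1 i hi)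
      · intro j _ hj
        by_cases hji : i = j
        · rw [← hji, ih1, mul_zero]
        by_cases hadj : (cycleGraph (m + 2)).Adj i j
        · rcases cycleGraph_adj.1 hadj with h | h
          · rwa [show j = i - 1 by rw [← h]; ring]
          · exact absurd (by rw [← h]; ring) hj
        · rw [h0 i j hji hadj, zero_mul]
      · simp
  funext i
  have := (key (i - (p + 1)).val).1
  rwa [Fin.cast_val_eq_self, add_sub_cancel] at this

/-- A two-dimensional space of eigenvectors meets the hyperplane `x i = 0` nontrivially. -/
theorem exists_ne_zero_mulVec_eq_smul_of_conj_diagonal {ι : Type*} [Fintype ι] [DecidableEq ι]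
    {d : ι → ℝ} {P Q : Matrix ι ι ℝ} (hPQ : P * Q = 1) {a b : ι} (hab : a ≠ b) (hd : d a = d b)
    (i : ι) : ∃ x : ι → ℝ, x ≠ 0 ∧ x i = 0 ∧
      (P * Matrix.diagonal d * Q).mulVec x = d a • x := by
  have hQP := mul_eq_one_comm.1 hPQ
  have main : ∀ y : ι → ℝ, y ≠ 0 → (∀ j, j ≠ a → j ≠ b → y j = 0) → P.mulVec y i = 0 →
      ∃ x : ι → ℝ, x ≠ 0 ∧ x i = 0 ∧ (P * Matrix.diagonal d * Q).mulVec x = d a • x := by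
    intro y hy hyj hyi
    refine ⟨P.mulVec y, fun h => hy ?_, hyi, ?_⟩
    · simpa [hQP] using congrArg Q.mulVec h
    · rw [Matrix.mulVec_mulVec, Matrix.mul_assoc, hQP, Matrix.mul_one, ← Matrix.mulVec_mulVec,
        ← Matrix.mulVec_smul]
      congr 1
      funext j
      rw [Matrix.mulVec_diagonal, Pi.smul_apply, smul_eq_mul]
      by_cases hja : j = a
      · rw [hja]
      by_cases hjb : j = b
      · rw [hjb, hd]
      · rw [hyj j hja hjb, mul_zero, mul_zero]
  by_cases hPa : P i a = 0
  · refine main (Pi.single a 1) (by simp) (fun j hj _ => by simp [hj]) ?_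
    simp [hPa]
  · refine main (P i b • Pi.single a 1 - P i a • Pi.single b 1) (fun h => hPa ?_)
      (fun j hja hjb => by simp [hja, hjb]) ?_
    · simpa [hab.symm] using congrFun h b
    · simp [Matrix.mulVec_sub, Matrix.mulVec_smul, mul_comm]

theorem Matrix.rootMultiplicity_charpoly_diagonal {ι : Type*} [Fintype ι] [DecidableEq ι]
    (d : ι → ℝ) (c : ℝ) : (Matrix.diagonal d).charpoly.rootMultiplicity c =
      (Finset.univ.filter fun i => d i = c).card := by
  classical
  rw [Matrix.charpoly_diagonal, ← Polynomial.count_roots]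
  have : (∏ i, (Polynomial.X - Polynomial.C (d i))) =
      ((Finset.univ.val.map d).map fun a => Polynomial.X - Polynomial.C a).prod := by
    rw [Multiset.map_map]; rfl
  rw [this, Polynomial.roots_multiset_prod_X_sub_C, Multiset.count_map, Finset.card_def,
    Finset.filter_val]
  simp_rw [eq_comm]

open Filter Topology in
theorem mainTheorem9 (n : ℕ) (hn : 3 ≤ n) (lam : Fin (n - 1) → ℝ) (hlam : StrictMono lam)
    (k : Fin (n - 1)) :
    ∃ A ∈ matricesOfGraph (SimpleGraph.cycleGraph n),
      HasSSP A ∧ A.charpoly.rootMultiplicity (lam k) = 2 ∧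
        ∀ i, i ≠ k → A.charpoly.rootMultiplicity (lam i) = 1 := by
  obtain ⟨m, rfl⟩ : ∃ m, n = m + 2 := ⟨n - 2, by omega⟩
  change Fin (m + 1) → ℝ at lam
  change Fin (m + 1) at k
  classical
  let G := SimpleGraph.cycleGraph (m + 2)
  let d : Fin (m + 2) → ℝ := fun i => lam (k.predAbove i)
  have hpred : ∀ i j : Fin (m + 2), k.predAbove i = k.predAbove j →
      i = j ∨ (i = k.castSucc ∧ j = k.succ) ∨ (i = k.succ ∧ j = k.castSucc) := by
    intro i j h
    have hval : ∀ a : Fin (m + 2),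
        (k.predAbove a).val = if k.val < a.val then a.val - 1 else a.val := by
      intro a
      simp only [Fin.predAbove, Fin.lt_def, Fin.val_castSucc]
      split_ifs <;> simp
    have h := congrArg Fin.val h
    rw [hval, hval] at h
    simp only [Fin.ext_iff, Fin.val_castSucc, Fin.val_succ]
    split_ifs at h <;> omega
  have hd : ∀ i j, d i = d j →
      i = j ∨ (i = k.castSucc ∧ j = k.succ) ∨ (i = k.succ ∧ j = k.castSucc) :=
    fun i j h => hpred i j (hlam.injective h)
  have hsucc : k.succ = k.castSucc + 1 := (Fin.coeSucc_eq_succ).symm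
  have hadj : G.Adj k.succ k.castSucc := by
    rw [SimpleGraph.cycleGraph_adj, hsucc]
    left; abel
  have hne : k.castSucc ≠ k.succ := hadj.ne.symm
  have hdk : d k.castSucc = lam k := by simp [d]
  have hdk' : d k.succ = lam k := by simp [d]
  let D := Matrix.diagonal d
  have hev := Matrix.eventually_exists_orthogonal_conj_diagonal d
    (Matrix.eventually_commutator_ne_zero d)
  have htend : Tendsto (fun ε : ℝ => D + ε • G.adjMatrix ℝ) (𝓝[≠] 0) (𝓝 D) := by
    have : Continuous fun ε : ℝ => D + ε • G.adjMatrix ℝ := by fun_prop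
    have h := this.tendsto 0
    simp only [zero_smul, add_zero] at h
    exact h.mono_left nhdsWithin_le_nhds
  obtain ⟨ε, hT, hε₀⟩ := ((htend.eventually hev).and self_mem_nhdsWithin).exists
  have hε : ε ≠ 0 := hε₀
  obtain ⟨Q, hQ, hSSP, hent⟩ := hT (by
    simp [Matrix.IsSymm, D])
  set A := Q.transpose * Matrix.diagonal d * Q with hA
  have hsymm : A.IsSymm := by
    simp [A, Matrix.IsSymm, Matrix.transpose_mul, Matrix.mul_assoc]
  have hent' : ∀ i j, d i ≠ d j → A i j = if G.Adj i j then ε else 0 := by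
    intro i j hij
    rw [hent i j hij]
    have : i ≠ j := fun h => hij (h ▸ rfl)
    simp [D, Matrix.diagonal_apply_ne _ this, SimpleGraph.adjMatrix_apply]
  have h0 : ∀ i j, i ≠ j → ¬G.Adj i j → A i j = 0 := by
    intro i j hij hG
    rw [hent', if_neg hG]
    intro h
    rcases hd i j h with h | ⟨rfl, rfl⟩ | ⟨rfl, rfl⟩
    · exact hij h
    · exact hG hadj.symm
    · exact hG hadj
  have hedge : A k.succ k.castSucc ≠ 0 := by
    intro hz
    obtain ⟨x, hx0, hxp, hx⟩ := exists_ne_zero_mulVec_eq_smul_of_conj_diagonal hQ hne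
      (hdk.trans hdk'.symm) k.succ
    refine hx0 (eq_zero_of_mulVec_eq_smul_of_path (p := k.castSucc) h0 (hsucc ▸ hz) ?_ hx
      (hsucc ▸ hxp))
    intro i hi
    have hG : G.Adj i (i + 1) := by
      rw [SimpleGraph.cycleGraph_adj]
      right; abel
    rw [hent', if_pos hG]
    · exact hε
    · intro h
      rcases hd i (i + 1) h with h | ⟨h, _⟩ | ⟨h, h'⟩
      · exact hG.ne h
      · exact hi h
      -- Stepping forward from `k.succ` to `k.castSucc` would need a cycle of length 2; this is
      -- where `3 ≤ n` enters.
      · have := congrArg Fin.val h'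
        rw [Fin.val_add_one, h, Fin.val_castSucc, Fin.val_succ] at this
        split_ifs at this with h2
        · have := congrArg Fin.val h2
          simp only [Fin.val_succ, Fin.val_last] at this
          omega
        · omega
  have hiff : ∀ i j, i ≠ j → (A i j ≠ 0 ↔ G.Adj i j) := by
    intro i j hij
    refine ⟨fun h => by_contra fun hG => h (h0 i j hij hG), fun hG => ?_⟩
    by_cases h : d i = d j
    · rcases hd i j h with h | ⟨rfl, rfl⟩ | ⟨rfl, rfl⟩
      · exact absurd h hij
      · rwa [hsymm.apply]
      · exact hedge
    · rwa [hent' i j h, if_pos hG]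
  have hchar : A.charpoly = (Matrix.diagonal d).charpoly := by
    rw [hA, Matrix.mul_assoc, Matrix.charpoly_mul_comm, Matrix.mul_assoc, mul_eq_one_comm.1 hQ,
      Matrix.mul_one]
  refine ⟨A, ⟨hsymm, hiff⟩, ?_, ?_, ?_⟩
  · intro X hX hAX hIX hcomm
    refine hSSP X (fun i j h => ?_) hcomm
    by_cases hij : i = j
    · subst hij
      simpa using congrFun (congrFun hIX i) i
    · have hG : G.Adj i j := by
        rcases hd i j h with h | ⟨rfl, rfl⟩ | ⟨rfl, rfl⟩
        · exact absurd h hij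
        · exact hadj.symm
        · exact hadj
      have := congrFun (congrFun hAX i) j
      rw [Matrix.hadamard_apply, Matrix.zero_apply] at this
      exact (mul_eq_zero.1 this).resolve_left ((hiff i j hij).2 hG)
  · rw [hchar, Matrix.rootMultiplicity_charpoly_diagonal,
      show (Finset.univ.filter fun i => d i = lam k) = {k.castSucc, k.succ} from ?_,
      Finset.card_pair hne]
    ext i
    simp only [Finset.mem_filter, Finset.mem_univ, true_and, Finset.mem_insert,
      Finset.mem_singleton]
    refine ⟨fun h => ?_, by rintro (rfl | rfl) <;> assumption⟩
    rcases hd i k.castSucc (h.trans hdk.symm) with h | ⟨h, _⟩ | ⟨h, _⟩ <;> simp [h]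
  · intro i hi
    rw [hchar, Matrix.rootMultiplicity_charpoly_diagonal, Finset.card_eq_one]
    obtain ⟨j, hj⟩ : ∃ j, k.predAbove j = i := by
      rcases le_total i k with h | h
      · exact ⟨i.castSucc, Fin.predAbove_castSucc_of_le _ _ h⟩
      · exact ⟨i.succ, Fin.predAbove_succ_of_le _ _ h⟩
    refine ⟨j, ?_⟩
    ext a
    simp only [Finset.mem_filter, Finset.mem_univ, true_and, Finset.mem_singleton]
    refine ⟨fun h => ?_, fun h => by rw [h, ← hj]⟩
    rcases hpred a j ((hlam.injective h).trans hj.symm) with h | ⟨_, rfl⟩ | ⟨_, rfl⟩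
    · exact h
    · exact absurd (by simpa using hj.symm) hi
    · exact absurd (by simpa using hj.symm) hi
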